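/- Let $\Theta\subset\mathbb R^m$ be a nonempty convex polyhedron (a finite intersection of closed half-spaces), let $f\colon\mathbb R^n\to\mathbb R$, $g\colon\mathbb R^n\to\mathbb R^m$, put $\Gamma:=\{x\in\mathbb R^n\mid g(x)\in\Theta\}$, and consider the problem $$\text{minimize } f(x)\quad\text{subject to } g(x)\in\Theta. \tag{P}$$ **Notation.** All spaces carry the Euclidean inner product and norm. For $\varphi\colon\mathbb R^d\to(-\infty,\infty]$ and $x$ with $\varphi(x)<\infty$ the regular subdifferential is $$\widehat\partial\varphi(x)=\Big\{v\;\Big|\;\liminf_{u\to x}\frac{\varphi(u)-\varphi(x)-\langle v,u-x\rangle}{\|u-x\|}\ge 0\Big\},$$ and the limiting subdifferential $\partial\varphi(x)$ is the set of all limits of sequences $v_k\in\widehat\partial\varphi(x_k)$ with $x_k\to x$ and $\varphi(x_k)\to\varphi(x)$; both are empty where $\varphi=\infty$. For a set $\Omega$ with indicator function $\delta_\Omega$ ($0$ on $\Omega$, $\infty$ elsewhere) put $\widehat N_\Omega:=\widehat\partial\delta_\Omega$ and $N_\Omega:=\partial\delta_\Omega$. The tangent cone $T_\Omega(x)$ consists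 of all $w$ for which there are $t_k\downarrow 0$ and $w_k\to w$ with $x+t_kw_k\in\Omega$ for all $k$, and the critical cone is $K_\Omega(x,v):=T_\Omega(x)\cap\{v\}^\perp$. For $f$ continuously differentiable around $\bar x$, the combined second-order subdifferential of $f$ at $\bar x$ is $$\breve\partial^2 f(\bar x)(w):=\big\{z\in\mathbb R^n\;\big|\;(z,-w)\in\widehat N_{\operatorname{gph}\partial f}(\bar x,\nabla f(\bar x))\big\},\qquad \operatorname{gph}\partial f=\{(x,v)\mid v\in\partial f(x)\}.$$ **Theorem.** Let $\bar x$ be a local minimizer of (P). Assume that around $\bar x$ the function $f$ is of class $\mathcal C^{1,1}$ (differentiable with Lipschitz continuous gradient) and $g$ is $\mathcal C^2$-smooth, and that the metric subregularity constraint qualification (MSCQ) holds at $\bar x$: there are a neighborhood $U$ of $\bar x$ and $\kappa>0$ with $$\operatorname{dist}(x;\Gamma)\le\kappa\,\operatorname{dist}(g(x);\Theta)\quad\text{for all }x\in U.$$ Then $\bar x$ satisfies the first-order optimality condition $$\nabla f(\bar x)+\nabla g(\bar x)^*\bar y=0\quad\text{for some }\bar y\in N_\Theta(g(\bar x)). \tag{1}$$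 If in addition the vector $\bar y$ in (1) is unique, then: (a) $\langle z,w\rangle+\langle w,\nabla^2\langle\bar y,g\rangle(\bar x)w\rangle\ge 0$ for all $w\in-K_\Gamma(\bar x,-\nabla f(\bar x))$ and all $z\in\breve\partial^2f(\bar x)(w)$; (b) if moreover $\bar x$ is a strong local minimizer of (P) with modulus $\sigma>0$, i.e. $f(x)\ge f(\bar x)+\frac{\sigma}{2}\|x-\bar x\|^2$ for all $x\in\Gamma$ near $\bar x$, then $$\langle z,w\rangle+\langle w,\nabla^2\langle\bar y,g\rangle(\bar x)w\rangle\ge\sigma\|w\|^2$$ for all $w\in-K_\Gamma(\bar x,-\nabla f(\bar x))$ and all $z\in\breve\partial^2f(\bar x)(w)$. -/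

import Mathlib

open Filter Topology

noncomputable section

namespace VarAnalysis

variable {E F : Type*}

/-! ### First-order generalized differentiation

Extended-real-valued functions `φ : E → (-∞, ∞]` are modelled as functions into `EReal`; the value
`-∞` is never taken by the functions considered below. -/

/-- The indicator function `δ_Ω`, equal to `0` on `Ω` and to `∞` outside of `Ω`. -/
def indicatorFun (Ω : Set E) (x : E) : EReal :=
  open Classical in if x ∈ Ω then 0 else ⊤

/-- The (Fréchet) regular subdifferential: `v ∈ ∂̂φ(x)` iff `φ(x) < ∞` and
`liminf_{u → x} (φ(u) - φ(x) - ⟨v, u - x⟩) / ‖u - x‖ ≥ 0`. -/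
def regularSubdiff [NormedAddCommGroup E] [InnerProductSpace ℝ E]
    (φ : E → EReal) (x : E) : Set E :=
  {v | φ x < ⊤ ∧
    0 ≤ liminf (fun u => (φ u - φ x - ((inner ℝ v (u - x) : ℝ) : EReal)) / ((‖u - x‖ : ℝ) : EReal))
      (𝓝[≠] x)}

/-- The (Mordukhovich) limiting subdifferential: the outer limit of the regular subdifferentials
along `x_k → x` with `φ(x_k) → φ(x)`. -/
def limitingSubdiff [NormedAddCommGroup E] [InnerProductSpace ℝ E]
    (φ : E → EReal) (x : E) : Set E :=
  {v | φ x < ⊤ ∧ ∃ (xs vs : ℕ → E),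
    Tendsto xs atTop (𝓝 x) ∧ Tendsto (fun k => φ (xs k)) atTop (𝓝 (φ x)) ∧
    Tendsto vs atTop (𝓝 v) ∧ ∀ k, vs k ∈ regularSubdiff φ (xs k)}

/-- The regular normal cone `N̂_Ω(x) = ∂̂δ_Ω(x)` (empty if `x ∉ Ω`). -/
def regularNormalCone [NormedAddCommGroup E] [InnerProductSpace ℝ E]
    (Ω : Set E) (x : E) : Set E :=
  regularSubdiff (indicatorFun Ω) x

/-- The limiting normal cone `N_Ω(x) = ∂δ_Ω(x)` (empty if `x ∉ Ω`). -/
def normalCone [NormedAddCommGroup E] [InnerProductSpace ℝ E]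
    (Ω : Set E) (x : E) : Set E :=
  limitingSubdiff (indicatorFun Ω) x

/-- The (Bouligand-Severi) tangent (contingent) cone `T_Ω(x)`. -/
def tangentCone [NormedAddCommGroup E] [InnerProductSpace ℝ E]
    (Ω : Set E) (x : E) : Set E :=
  {w | ∃ (t : ℕ → ℝ) (ws : ℕ → E),
    (∀ k, 0 < t k) ∧ Tendsto t atTop (𝓝 0) ∧ Tendsto ws atTop (𝓝 w) ∧
    ∀ k, x + t k • ws k ∈ Ω}

/-- The critical cone `K_Ω(x, v) = T_Ω(x) ∩ {v}^⊥`. -/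
def criticalCone [NormedAddCommGroup E] [InnerProductSpace ℝ E]
    (Ω : Set E) (x v : E) : Set E :=
  tangentCone Ω x ∩ {w | inner ℝ v w = 0}

/-! ### Coderivatives and the combined second-order subdifferential -/

/-- The graph of a set-valued mapping, in the product with its Euclidean (`ℓ²`) structure. -/
def gph [NormedAddCommGroup E] [NormedAddCommGroup F] (M : E → Set F) : Set (WithLp 2 (E × F)) :=
  {p | p.snd ∈ M p.fst}

/-- The regular coderivative: `v ∈ D̂*M(x, y)(u)` iff `(v, -u) ∈ N̂_{gph M}(x, y)`. -/
def regularCoderiv [NormedAddCommGroup E] [InnerProductSpace ℝ E]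
    [NormedAddCommGroup F] [InnerProductSpace ℝ F]
    (M : E → Set F) (x : E) (y : F) (u : F) : Set E :=
  {v | WithLp.toLp 2 (v, -u) ∈ regularNormalCone (gph M) (WithLp.toLp 2 (x, y))}

/-- The combined second-order subdifferential `(D̂*∂φ)(x, v)(u)`. -/
def combinedSecondSubdiff [NormedAddCommGroup E] [InnerProductSpace ℝ E]
    (φ : E → EReal) (x v u : E) : Set E :=
  regularCoderiv (limitingSubdiff φ) x v u

/-- The combined second-order subdifferential of a real-valued function `f` which is continuously
differentiable around `x`; the subgradient is then `∇f(x)`. -/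
def combinedSecondSubdiffReal [NormedAddCommGroup E] [InnerProductSpace ℝ E] [CompleteSpace E]
    (f : E → ℝ) (x u : E) : Set E :=
  combinedSecondSubdiff (fun x' => (f x' : EReal)) x (gradient f x) u

/-! ### The constrained problem: minimize `f(x)` subject to `g(x) ∈ Θ` -/

/-- `f` is of class `C^{1,1}` around `x`: it is differentiable with a Lipschitz continuous gradient
on a neighborhood of `x`. -/
def IsC11Around [NormedAddCommGroup E] [InnerProductSpace ℝ E] [CompleteSpace E]
    (f : E → ℝ) (x : E) : Prop :=
  ∃ U ∈ 𝓝 x, (∀ u ∈ U, DifferentiableAt ℝ f u) ∧ ∃ L, LipschitzOnWith L (gradient f) U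

/-- A convex polyhedron: a finite intersection of closed half-spaces. -/
def IsConvexPolyhedron [NormedAddCommGroup F] [InnerProductSpace ℝ F] (Θ : Set F) : Prop :=
  ∃ (p : ℕ) (a : Fin p → F) (b : Fin p → ℝ), Θ = {y | ∀ i, inner ℝ (a i) y ≤ b i}

/-- The feasible set `Γ = {x | g(x) ∈ Θ}`. -/
def feasibleSet (g : E → F) (Θ : Set F) : Set E :=
  {x | g x ∈ Θ}

/-- The metric subregularity constraint qualification at a feasible point `x`:
`dist(u; Γ) ≤ κ dist(g(u); Θ)` for all `u` near `x`, with some `κ > 0`. -/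
def MSCQ [NormedAddCommGroup E] [NormedAddCommGroup F] (g : E → F) (Θ : Set F) (x : E) : Prop :=
  ∃ κ > (0 : ℝ), ∃ U ∈ 𝓝 x, ∀ u ∈ U,
    Metric.infDist u (feasibleSet g Θ) ≤ κ * Metric.infDist (g u) Θ

/-- `x` is a local minimizer of `f` subject to the constraint set `Γ`. -/
def IsLocalMinimizer [NormedAddCommGroup E] (f : E → ℝ) (Γ : Set E) (x : E) : Prop :=
  x ∈ Γ ∧ IsLocalMinOn f Γ x

/-- `x` is a strong local minimizer of `f` with modulus `σ` subject to the constraint set `Γ`. -/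
def IsStrongLocalMinimizer [NormedAddCommGroup E] (f : E → ℝ) (Γ : Set E) (σ : ℝ) (x : E) : Prop :=
  x ∈ Γ ∧ ∃ U ∈ 𝓝 x, ∀ u ∈ U, u ∈ Γ → f x + σ / 2 * ‖u - x‖ ^ 2 ≤ f u

/-- The vectors `y ∈ N_Θ(g(x))` satisfying the first-order optimality condition
`∇f(x) + ∇g(x)^* y = 0`. -/
def multipliers [NormedAddCommGroup E] [InnerProductSpace ℝ E] [CompleteSpace E]
    [NormedAddCommGroup F] [InnerProductSpace ℝ F] [CompleteSpace F]
    (f : E → ℝ) (g : E → F) (Θ : Set F) (x : E) : Set F :=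
  {y | y ∈ normalCone Θ (g x) ∧ gradient f x + ContinuousLinearMap.adjoint (fderiv ℝ g x) y = 0}

/-- The Hessian `∇²⟨y, g⟩(x)` of the scalarized mapping, as a linear operator. -/
def scalarizedHessian [NormedAddCommGroup E] [InnerProductSpace ℝ E] [CompleteSpace E]
    [NormedAddCommGroup F] [InnerProductSpace ℝ F]
    (g : E → F) (y : F) (x : E) : E →L[ℝ] E :=
  fderiv ℝ (gradient (fun x' => (inner ℝ y (g x') : ℝ))) x

end VarAnalysis

end

/-! Write Θ by finitely many affine inequalities. MSCQ turns a curve that satisfies the constraints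
up to `o(t ^ k)` into a feasible curve at distance `o(t ^ k)` (`MSCQ.exists_feasible_curve`). With
`k = 1`, minimality makes `∇f(x)` nonnegative on the linearized cone, and Farkas' lemma yields a
multiplier.

With `k = 2`, the parabola `x - t w + (t² / 2) p` is corrected, where `p` satisfies the second-order
inequalities of those constraints that stay active to first order along `-w`. The normal inequality
for `(z, -w)` on the graph of `∇f` bounds the derivative of `f` along the ray `x - t w`; integrating
gives `f(x - t w) - f(x) ≤ (t² / 2)(⟨z, w⟩ + ε)`. This is why the critical direction is `-w`. The
term in `p` adds `(t² / 2)⟨∇f(x), p⟩`, and comparison with the growth of `f` gives `σ‖w‖² ≤ ⟨z, w⟩ +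
⟨∇f(x), p⟩` (`le_of_second_order_feasible`).

Finally, linear programming duality and uniqueness of the multiplier `y` supply a `p` with `⟨∇f(x),
p⟩ ≤ ⟨y, g''(x)(w, w)⟩` (`exists_second_order_direction`). -/

/-! ### Theorems of the alternative -/

/-- Farkas' lemma for finitely many linear functionals. -/
theorem exists_nonneg_combination_of_forall_nonpos {ι V : Type*} [AddCommGroup V] [Module ℝ V]
    (s : Finset ι) (A : ι → V →ₗ[ℝ] ℝ) (c : V →ₗ[ℝ] ℝ)
    (h : ∀ x, (∀ i ∈ s, A i x ≤ 0) → c x ≤ 0) :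
    ∃ l : ι → ℝ, (∀ i, 0 ≤ l i) ∧ c = ∑ i ∈ s, l i • A i := by
  classical
  induction s using Finset.induction_on generalizing A c with
  | empty =>
    refine ⟨0, fun _ => le_rfl, ?_⟩
    ext x
    have h1 := h x (by simp)
    have h2 := h (-x) (by simp)
    rw [map_neg] at h2
    simpa using le_antisymm h1 (by linarith)
  | insert j s hj ih =>
    by_cases hs : ∀ x, (∀ i ∈ s, A i x ≤ 0) → c x ≤ 0
    · obtain ⟨l, hl, hc⟩ := ih A c hs
      refine ⟨Function.update l j 0, fun i => ?_, ?_⟩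
      · by_cases hi : i = j
        · simp [hi]
        · simpa [hi] using hl i
      · rw [Finset.sum_insert hj, hc]
        simp only [Function.update_self, zero_smul, zero_add]
        refine Finset.sum_congr rfl fun i hi => ?_
        rw [Function.update_of_ne (ne_of_mem_of_not_mem hi hj)]
    · push Not at hs
      obtain ⟨x₁, hx₁, hcx₁⟩ := hs
      have hjx : 0 < A j x₁ := by
        by_contra hcon
        push Not at hcon
        exact absurd (h x₁ (Finset.forall_mem_insert _ _ _ |>.2 ⟨hcon, hx₁⟩)) (not_le.2 hcx₁)
      set x₀ := (A j x₁)⁻¹ • x₁ with hx₀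
      have hjx₀ : A j x₀ = 1 := by simp [hx₀, hjx.ne']
      have hsx₀ : ∀ i ∈ s, A i x₀ ≤ 0 := fun i hi => by
        simp only [hx₀, map_smul, smul_eq_mul]
        exact mul_nonpos_of_nonneg_of_nonpos (inv_nonneg.2 hjx.le) (hx₁ i hi)
      have hcx₀ : 0 ≤ c x₀ := by
        simp only [hx₀, map_smul, smul_eq_mul]
        positivity
      -- These functionals are `A i` and `c` precomposed with the projection `x ↦ x - A j x • x₀`
      -- onto the kernel of `A j`, where constraint `j` holds trivially.
      obtain ⟨l, hl, hc⟩ := ih (fun i => A i - A i x₀ • A j) (c - c x₀ • A j) (fun x hx => by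
        have := h (x - A j x • x₀) (Finset.forall_mem_insert _ _ _ |>.2 ⟨by simp [hjx₀],
          fun i hi => by
            have := hx i hi
            simp only [LinearMap.sub_apply, LinearMap.smul_apply, smul_eq_mul, map_sub,
              map_smul] at this ⊢
            linarith⟩)
        simp only [LinearMap.sub_apply, LinearMap.smul_apply, smul_eq_mul, map_sub,
          map_smul] at this ⊢
        linarith)
      have hnn : 0 ≤ c x₀ - ∑ i ∈ s, l i * A i x₀ :=
        sub_nonneg.2 <| (Finset.sum_nonpos fun i hi =>
          mul_nonpos_of_nonneg_of_nonpos (hl i) (hsx₀ i hi)).trans hcx₀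
      refine ⟨Function.update l j (c x₀ - ∑ i ∈ s, l i * A i x₀), fun i => ?_, ?_⟩
      · by_cases hi : i = j
        · simpa [hi] using hnn
        · simpa [hi] using hl i
      · rw [Finset.sum_insert hj, Function.update_self,
          Finset.sum_congr rfl (g := fun i => l i • A i) fun i hi => by
            rw [Function.update_of_ne (ne_of_mem_of_not_mem hi hj)]]
        ext x
        have hx := LinearMap.congr_fun hc x
        simp only [smul_sub, Finset.sum_sub_distrib, LinearMap.add_apply, LinearMap.sub_apply,
          LinearMap.smul_apply, LinearMap.sum_apply, smul_eq_mul, sub_mul, Finset.sum_mul,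
          mul_assoc] at hx ⊢
        linarith

/-- Farkas' lemma for a finite system of affine inequalities. -/
theorem exists_forall_le_of_forall_combination {ι V : Type*} [AddCommGroup V] [Module ℝ V]
    (s : Finset ι) (A : ι → V →ₗ[ℝ] ℝ) (r : ι → ℝ)
    (h : ∀ l : ι → ℝ, (∀ i, 0 ≤ l i) → ∑ i ∈ s, l i • A i = 0 → 0 ≤ ∑ i ∈ s, l i * r i) :
    ∃ p, ∀ i ∈ s, A i p ≤ r i := by
  by_contra hcon
  push Not at hcon
  -- Homogenization: a pair `(q, τ)` with `τ > 0` satisfying all inequalities would make `q / τ` a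
  -- solution, so the homogeneous system forces `τ ≤ 0`.
  obtain ⟨l, hl, hc⟩ := exists_nonneg_combination_of_forall_nonpos s
    (fun i => (A i).comp (LinearMap.fst ℝ V ℝ) - r i • LinearMap.snd ℝ V ℝ)
    (LinearMap.snd ℝ V ℝ) (fun q hq => by
      by_contra hpos
      simp only [LinearMap.snd_apply, not_le] at hpos
      obtain ⟨i, hi, hlt⟩ := hcon (q.2⁻¹ • q.1)
      have := hq i hi
      simp only [LinearMap.sub_apply, LinearMap.comp_apply, LinearMap.fst_apply,
        LinearMap.smul_apply, LinearMap.snd_apply, smul_eq_mul, map_smul] at this hlt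
      rw [inv_mul_eq_div, lt_div_iff₀ hpos] at hlt
      linarith)
  have h1 : ∑ i ∈ s, l i • A i = 0 := by
    ext p
    have := LinearMap.congr_fun hc (p, 0)
    simpa using this.symm
  have h2 := LinearMap.congr_fun hc (0, 1)
  simp only [LinearMap.snd_apply, LinearMap.sum_apply, LinearMap.smul_apply, LinearMap.sub_apply,
    LinearMap.comp_apply, LinearMap.fst_apply, map_zero, smul_eq_mul, mul_one, zero_sub, mul_neg,
    Finset.sum_neg_distrib] at h2
  linarith [h l hl h1]

namespace VarAnalysis

/-! ### Subgradients, normals and growth of `C^{1,1}` functions -/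

section Subdifferentials

variable {E F : Type*} [NormedAddCommGroup E] [InnerProductSpace ℝ E]
  [NormedAddCommGroup F] [InnerProductSpace ℝ F]

theorem gradient_mem_regularSubdiff [CompleteSpace E] {f : E → ℝ} {x : E}
    (hf : DifferentiableAt ℝ f x) :
    gradient f x ∈ regularSubdiff (fun u => (f u : EReal)) x := by
  refine ⟨EReal.coe_lt_top _, ?_⟩
  have hlim := hasGradientAt_iff_isLittleO.1 hf.hasGradientAt
  refine EReal.ge_of_forall_gt_iff_ge.1 fun c hc => ?_
  have hc : c < 0 := EReal.coe_lt_coe_iff.1 hc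
  refine le_liminf_of_le (by isBoundedDefault) ?_
  filter_upwards [nhdsWithin_le_nhds (hlim.def (neg_pos.2 hc)), self_mem_nhdsWithin] with u hu hux
  have hpos : 0 < ‖u - x‖ := norm_pos_iff.2 (sub_ne_zero.2 hux)
  rw [← EReal.coe_sub, ← EReal.coe_sub, ← EReal.coe_div, EReal.coe_le_coe_iff, le_div_iff₀ hpos]
  linarith [(abs_le.1 hu).1]

theorem gradient_mem_limitingSubdiff [CompleteSpace E] {f : E → ℝ} {x : E}
    (hf : DifferentiableAt ℝ f x) :
    gradient f x ∈ limitingSubdiff (fun u => (f u : EReal)) x :=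
  ⟨EReal.coe_lt_top _, fun _ => x, fun _ => gradient f x, tendsto_const_nhds,
    tendsto_const_nhds, tendsto_const_nhds, fun _ => gradient_mem_regularSubdiff hf⟩

theorem mem_normalCone_of_forall_inner_nonpos {Θ : Set F} {x y : F} (hx : x ∈ Θ)
    (hy : ∀ u ∈ Θ, inner ℝ y (u - x) ≤ 0) : y ∈ normalCone Θ x := by
  have hreg : y ∈ regularSubdiff (indicatorFun Θ) x := by
    refine ⟨by simp [indicatorFun, hx], ?_⟩
    refine le_liminf_of_le (by isBoundedDefault) ?_
    filter_upwards [self_mem_nhdsWithin] with u hu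
    have hpos : 0 < ‖u - x‖ := norm_pos_iff.2 (sub_ne_zero.2 hu)
    refine EReal.div_nonneg ?_ (EReal.coe_nonneg.2 hpos.le)
    by_cases hu' : u ∈ Θ
    · simp only [indicatorFun, hx, hu', if_true, sub_zero, zero_sub]
      rw [← EReal.coe_neg]
      exact EReal.coe_nonneg.2 (neg_nonneg.2 (hy u hu'))
    · simp [indicatorFun, hx, hu']
  exact ⟨by simp [indicatorFun, hx], fun _ => x, fun _ => y, tendsto_const_nhds,
    tendsto_const_nhds, tendsto_const_nhds, fun _ => hreg⟩

theorem eventually_inner_le_of_mem_regularNormalCone {Ω : Set E} {x v : E}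
    (hv : v ∈ regularNormalCone Ω x) {ε : ℝ} (hε : 0 < ε) :
    ∀ᶠ u in 𝓝 x, u ∈ Ω → inner ℝ v (u - x) ≤ ε * ‖u - x‖ := by
  obtain ⟨hlt, hlim⟩ := hv
  have hx : x ∈ Ω := by
    by_contra hx
    simp [indicatorFun, hx] at hlt
  have hlt : ((-ε : ℝ) : EReal) < liminf (fun u => (indicatorFun Ω u - indicatorFun Ω x -
      ((inner ℝ v (u - x) : ℝ) : EReal)) / ((‖u - x‖ : ℝ) : EReal)) (𝓝[≠] x) :=
    lt_of_lt_of_le (EReal.coe_lt_coe_iff.2 (neg_lt_zero.2 hε)) hlim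
  have := eventually_lt_of_lt_liminf hlt (by isBoundedDefault)
  rw [eventually_nhdsWithin_iff] at this
  filter_upwards [this] with u hu huΩ
  by_cases hux : u = x
  · simp [hux]
  have hpos : 0 < ‖u - x‖ := norm_pos_iff.2 (sub_ne_zero.2 hux)
  have h := hu hux
  simp only [indicatorFun, hx, huΩ, if_true, sub_zero, zero_sub] at h
  rw [← EReal.coe_neg, ← EReal.coe_div, EReal.coe_lt_coe_iff, lt_div_iff₀ hpos] at h
  linarith

/-- The points `(u, ∇f(u))` lie on the graph of the subdifferential, and the Lipschitz bound makes
their distance to the base point at most `(1 + L)‖u - x‖`. Hence the normal inequality becomes one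
in `u` alone; only `∇f(u) ∈ ∂f(u)` is needed, not equality. -/
theorem eventually_inner_le_of_mem_combinedSecondSubdiffReal [CompleteSpace E] {f : E → ℝ}
    {x w z : E} (hf : IsC11Around f x) (hz : z ∈ combinedSecondSubdiffReal f x w)
    {ε : ℝ} (hε : 0 < ε) :
    ∀ᶠ u in 𝓝 x, inner ℝ z (u - x) - inner ℝ w (gradient f u - gradient f x) ≤
      ε * ‖u - x‖ := by
  obtain ⟨U, hU, hd, L, hL⟩ := hf
  have hcont : ContinuousAt (gradient f) x := hL.continuousOn.continuousAt hU
  have hmap : Tendsto (fun u => WithLp.toLp 2 (u, gradient f u)) (𝓝 x)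
      (𝓝 (WithLp.toLp 2 (x, gradient f x))) :=
    ((WithLp.prod_continuous_toLp 2 E E).tendsto _).comp
      (tendsto_id.prodMk_nhds hcont.tendsto)
  have h := hmap.eventually (eventually_inner_le_of_mem_regularNormalCone hz
    (ε := ε / (1 + L)) (by positivity))
  filter_upwards [h, hU] with u hu huU
  have hmem : WithLp.toLp 2 (u, gradient f u) ∈
      gph (limitingSubdiff fun x' => (f x' : EReal)) := gradient_mem_limitingSubdiff (hd u huU)
  have hu := hu hmem
  have hLu : ‖gradient f u - gradient f x‖ ≤ L * ‖u - x‖ := by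
    simpa [dist_eq_norm] using hL.dist_le_mul u huU x (mem_of_mem_nhds hU)
  have hnorm : ‖WithLp.toLp 2 (u, gradient f u) - WithLp.toLp 2 (x, gradient f x)‖ ≤
      (1 + L) * ‖u - x‖ := by
    rw [← WithLp.toLp_sub, Prod.mk_sub_mk, WithLp.prod_norm_eq_of_L2]
    refine Real.sqrt_le_iff.2 ⟨by positivity, ?_⟩
    change ‖u - x‖ ^ 2 + ‖gradient f u - gradient f x‖ ^ 2 ≤ _
    nlinarith [norm_nonneg (u - x), norm_nonneg (gradient f u - gradient f x),
      mul_nonneg L.coe_nonneg (norm_nonneg (u - x)),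
      pow_le_pow_left₀ (norm_nonneg _) hLu 2]
  have hinner : inner ℝ (WithLp.toLp 2 (z, -w))
      (WithLp.toLp 2 (u, gradient f u) - WithLp.toLp 2 (x, gradient f x)) =
      inner ℝ z (u - x) - inner ℝ w (gradient f u - gradient f x) := by
    rw [WithLp.prod_inner_apply, sub_eq_add_neg (inner ℝ z (u - x)), ← inner_neg_left]
    rfl
  rw [hinner] at hu
  calc _ ≤ ε / (1 + L) * ‖WithLp.toLp 2 (u, gradient f u) - WithLp.toLp 2 (x, gradient f x)‖ := hu
    _ ≤ ε / (1 + L) * ((1 + L) * ‖u - x‖) := by gcongr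
    _ = ε * ‖u - x‖ := by
        have : (1 + L : ℝ) ≠ 0 := by positivity
        field_simp

/-- The values of `f` along the ray in direction `-w` grow at most quadratically, with a rate
governed by any `z` in the combined second-order subdifferential. -/
theorem eventually_le_of_mem_combinedSecondSubdiffReal [CompleteSpace E] {f : E → ℝ}
    {x w z : E} (hf : IsC11Around f x) (hz : z ∈ combinedSecondSubdiffReal f x w)
    {ε : ℝ} (hε : 0 < ε) :
    ∀ᶠ t : ℝ in 𝓝[>] 0, f (x + t • -w) - f x - t * inner ℝ (gradient f x) (-w) ≤
      t ^ 2 / 2 * (inner ℝ z w + ε) := by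
  have hray : Tendsto (fun t : ℝ => x + t • -w) (𝓝 0) (𝓝 x) := by
    have : Continuous fun t : ℝ => x + t • -w := by fun_prop
    simpa using this.tendsto 0
  obtain ⟨U, hU, hd, -⟩ := id hf
  have hev := hray.eventually ((eventually_inner_le_of_mem_combinedSecondSubdiffReal hf hz
    (ε := ε / (‖w‖ + 1)) (by positivity)).and hU)
  obtain ⟨δ, hδ, hball⟩ := Metric.eventually_nhds_iff.1 hev
  filter_upwards [Ioo_mem_nhdsGT hδ] with t ht
  -- At `u = x - s w` the normal inequality says exactly that `ψ` has nonpositive derivative; the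
  -- choice `ε / (‖w‖ + 1)` absorbs `‖u - x‖ = s‖w‖`, also when `w = 0`.
  set ψ : ℝ → ℝ := fun s => f (x + s • -w) - s * inner ℝ (gradient f x) (-w) -
    s ^ 2 / 2 * (inner ℝ z w + ε) with hψ
  have hder : ∀ s ∈ Set.Icc 0 t, HasDerivAt ψ (inner ℝ (gradient f (x + s • -w)) (-w) -
      inner ℝ (gradient f x) (-w) - s * (inner ℝ z w + ε)) s := fun s hs => by
    have hs' := hball (y := s) (by simpa [abs_of_nonneg hs.1] using hs.2.trans_lt ht.2)
    have h1 : HasDerivAt (fun s : ℝ => x + s • -w) (-w) s := by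
      simpa using ((hasDerivAt_id s).smul_const (-w)).const_add x
    have h2 := (hd _ hs'.2).hasGradientAt.hasFDerivAt.comp_hasDerivAt s h1
    have h3 := (hasDerivAt_id s).mul_const (inner ℝ (gradient f x) (-w))
    have h4 := (((hasDerivAt_id s).pow 2).div_const 2).mul_const (inner ℝ z w + ε)
    refine ((h2.sub h3).sub h4).congr_deriv ?_
    simp only [InnerProductSpace.toDual_apply_apply, id_eq, Nat.cast_ofNat]
    ring
  have hanti : AntitoneOn ψ (Set.Icc 0 t) := by
    refine antitoneOn_of_deriv_nonpos (convex_Icc 0 t)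
      (fun s hs => (hder s hs).continuousAt.continuousWithinAt)
      (fun s hs => (hder s (interior_subset hs)).differentiableAt.differentiableWithinAt)
      fun s hs => ?_
    have hs := interior_subset hs
    rw [(hder s hs).deriv]
    have hs' := (hball (y := s) (by simpa [abs_of_nonneg hs.1] using hs.2.trans_lt ht.2)).1
    rw [add_sub_cancel_left, norm_smul, norm_neg, Real.norm_of_nonneg hs.1] at hs'
    have hb : ε / (‖w‖ + 1) * (s * ‖w‖) ≤ s * ε := by
      rw [div_mul_eq_mul_div, div_le_iff₀ (by positivity)]
      nlinarith [mul_nonneg hs.1 hε.le]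
    simp only [inner_smul_right, inner_neg_right, inner_sub_right] at hs' ⊢
    rw [real_inner_comm w, real_inner_comm w (gradient f x)]
    linarith
  have := hanti (Set.left_mem_Icc.2 ht.1.le) (Set.right_mem_Icc.2 ht.1.le) ht.1.le
  simp only [hψ, zero_smul, add_zero] at this
  linarith

/-- The linearization error of a `C^{1,1}` function is locally Lipschitz, with a constant
proportional to the distance from the base point. -/
theorem IsC11Around.exists_abs_sub_sub_inner_le [CompleteSpace E] {f : E → ℝ} {x : E}
    (hf : IsC11Around f x) :
    ∃ L : ℝ, 0 ≤ L ∧ ∃ δ > 0, ∀ r ≤ δ, ∀ u ∈ Metric.closedBall x r, ∀ u' ∈ Metric.closedBall x r,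
      |f u' - f u - inner ℝ (gradient f x) (u' - u)| ≤ L * r * ‖u' - u‖ := by
  obtain ⟨U, hU, hd, L, hL⟩ := hf
  obtain ⟨δ, hδ, hball⟩ := Metric.nhds_basis_closedBall.mem_iff.1 hU
  refine ⟨L, L.coe_nonneg, δ, hδ, fun r hr u hu u' hu' => ?_⟩
  have hsub : Metric.closedBall x r ⊆ U := (Metric.closedBall_subset_closedBall hr).trans hball
  have := (convex_closedBall x r).norm_image_sub_le_of_norm_hasFDerivWithin_le' (f := f)
    (f' := fun v => InnerProductSpace.toDual ℝ E (gradient f v))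
    (φ := InnerProductSpace.toDual ℝ E (gradient f x)) (C := L * r)
    (fun v hv => (hd v (hsub hv)).hasGradientAt.hasFDerivAt.hasFDerivWithinAt)
    (fun v hv => by
      rw [← map_sub, LinearIsometryEquiv.norm_map, ← dist_eq_norm]
      exact (hL.dist_le_mul v (hsub hv) x (mem_of_mem_nhds hU)).trans
        (mul_le_mul_of_nonneg_left hv L.coe_nonneg)) hu hu'
  simpa using this

end Subdifferentials

end VarAnalysis

/-! ### Taylor expansion of curves -/

/-- Second-order Taylor expansion of a curve at `0`. -/
theorem isLittleO_sq_of_hasDerivAt {F : Type*} [NormedAddCommGroup F] [NormedSpace ℝ F]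
    {G D : ℝ → F} {D' : F} (hG : ∀ᶠ t in 𝓝 0, HasDerivAt G (D t) t) (hD : HasDerivAt D D' 0) :
    (fun t => G t - (G 0 + t • D 0 + (t ^ 2 / 2) • D')) =o[𝓝 0] fun t : ℝ => t ^ 2 := by
  refine Asymptotics.isLittleO_iff.2 fun ε hε => ?_
  have hev := hG.and ((hasDerivAt_iff_isLittleO.1 hD).def hε)
  obtain ⟨δ, hδ, hball⟩ := Metric.eventually_nhds_iff.1 hev
  filter_upwards [Metric.ball_mem_nhds 0 hδ] with t ht
  have hsub : ∀ s ∈ Metric.closedBall (0 : ℝ) |t|, dist s 0 < δ := fun s hs =>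
    lt_of_le_of_lt hs (by simpa using ht)
  have := (convex_closedBall (0 : ℝ) |t|).norm_image_sub_le_of_norm_hasDerivWithin_le
    (f := fun t => G t - (G 0 + t • D 0 + (t ^ 2 / 2) • D'))
    (f' := fun t => D t - D 0 - t • D') (C := ε * |t|) (x := 0) (y := t)
    (fun s hs => by
      have h1 := (hasDerivAt_id s).smul_const (D 0)
      have h2 := (((hasDerivAt_id s).pow 2).div_const 2).smul_const D'
      refine (((hball (hsub s hs)).1.sub ((h1.const_add (G 0)).add h2)).congr_deriv
        ?_).hasDerivWithinAt
      have : (((2 : ℕ) : ℝ) * id s ^ (2 - 1) * 1) / 2 = s := by simp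
      rw [this, one_smul, sub_sub])
    (fun s hs => by
      have := (hball (hsub s hs)).2
      simp only [sub_zero] at this
      exact this.trans (mul_le_mul_of_nonneg_left (by simpa using hs) hε.le))
    (by simp) (by simp)
  simpa [mul_assoc, ← pow_two] using this

namespace VarAnalysis

/-! ### Feasible corrections under metric subregularity -/

section Feasibility

variable {E F : Type*} [NormedAddCommGroup E] [NormedAddCommGroup F]

/-- Under MSCQ, an almost feasible curve can be corrected to a feasible one. -/
theorem MSCQ.exists_feasible_curve {g : E → F} {Θ : Set F} {x : E} (h : MSCQ g Θ x)
    (hx : g x ∈ Θ) {c : ℝ → E} {θ : ℝ → F} {k : ℕ} (hc : Tendsto c (𝓝[>] 0) (𝓝 x))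
    (hθ : ∀ᶠ t in 𝓝[>] 0, θ t ∈ Θ)
    (ho : (fun t => g (c t) - θ t) =o[𝓝[>] 0] fun t => t ^ k) :
    ∃ u : ℝ → E, (∀ᶠ t in 𝓝[>] 0, u t ∈ feasibleSet g Θ) ∧
      (fun t => u t - c t) =o[𝓝[>] 0] fun t => t ^ k := by
  obtain ⟨κ, hκ, U, hU, hUκ⟩ := h
  have hne : (feasibleSet g Θ).Nonempty := ⟨x, hx⟩
  -- The distance need not be attained, so a near-projection is taken; its slack `t ^ (k + 1)` is
  -- itself `o(t ^ k)`.
  have hex : ∀ t : ℝ, ∃ u, 0 < t → u ∈ feasibleSet g Θ ∧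
      dist (c t) u < Metric.infDist (c t) (feasibleSet g Θ) + t ^ (k + 1) := fun t => by
    by_cases ht : 0 < t
    · obtain ⟨u, hu⟩ := (Metric.infDist_lt_iff hne).1
        (lt_add_of_pos_right (Metric.infDist (c t) (feasibleSet g Θ)) (pow_pos ht (k + 1)))
      exact ⟨u, fun _ => hu⟩
    · exact ⟨x, fun h => absurd h ht⟩
  choose u hu using hex
  refine ⟨u, ?_, ?_⟩
  · filter_upwards [self_mem_nhdsWithin] with t ht using (hu t ht).1
  have hsum : (fun t => κ * ‖g (c t) - θ t‖ + t ^ (k + 1)) =o[𝓝[>] 0] fun t => t ^ k :=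
    (ho.norm_left.const_mul_left κ).add
      ((Asymptotics.isLittleO_pow_pow (Nat.lt_succ_self k)).mono nhdsWithin_le_nhds)
  refine Asymptotics.IsBigO.trans_isLittleO (Asymptotics.IsBigO.of_bound 1 ?_) hsum
  filter_upwards [self_mem_nhdsWithin, hθ, hc hU] with t ht hθt hct
  rw [one_mul, ← dist_eq_norm, dist_comm]
  refine le_trans ?_ (Real.le_norm_self _)
  have h1 : Metric.infDist (g (c t)) Θ ≤ ‖g (c t) - θ t‖ := by
    rw [← dist_eq_norm]; exact Metric.infDist_le_dist_of_mem hθt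
  have h2 := hUκ _ hct
  have h3 := mul_le_mul_of_nonneg_left h1 hκ.le
  linarith [(hu t ht).2]

end Feasibility

/-! ### Tangents and normals of polyhedra -/

section Polyhedra

variable {F ι : Type*} [NormedAddCommGroup F] [InnerProductSpace ℝ F]

/-- Second-order tangent directions to a polyhedron are feasible for small steps. -/
theorem eventually_parabola_mem_polyhedron [Finite ι] {a : ι → F} {b : ι → ℝ} {q₀ q₁ q₂ : F}
    (h₀ : ∀ i, inner ℝ (a i) q₀ ≤ b i) (h₁ : ∀ i, inner ℝ (a i) q₀ = b i → inner ℝ (a i) q₁ ≤ 0)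
    (h₂ : ∀ i, inner ℝ (a i) q₀ = b i → inner ℝ (a i) q₁ = 0 → inner ℝ (a i) q₂ ≤ 0) :
    ∀ᶠ t : ℝ in 𝓝[>] 0, q₀ + t • q₁ + (t ^ 2 / 2) • q₂ ∈ {q | ∀ i, inner ℝ (a i) q ≤ b i} := by
  refine eventually_all.2 fun i => ?_
  simp only [inner_add_right, inner_smul_right]
  rcases (h₀ i).lt_or_eq with hlt | heq
  · have hcont : Continuous fun t : ℝ => inner ℝ (a i) q₀ + t * inner ℝ (a i) q₁ +
        t ^ 2 / 2 * inner ℝ (a i) q₂ := by fun_prop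
    have := (hcont.tendsto 0).eventually_lt_const (u := b i) (by simpa using hlt)
    filter_upwards [nhdsWithin_le_nhds this] with t ht using ht.le
  · rcases (h₁ i heq).lt_or_eq with hlt | heq₁
    · have hcont : Continuous fun t : ℝ => inner ℝ (a i) q₁ + t / 2 * inner ℝ (a i) q₂ := by
        fun_prop
      have := (hcont.tendsto 0).eventually_lt_const (u := 0) (by simpa using hlt)
      filter_upwards [nhdsWithin_le_nhds this, self_mem_nhdsWithin] with t ht hpos
      have := mul_neg_of_pos_of_neg hpos ht
      rw [heq]
      linarith
    · filter_upwards with t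
      rw [heq, heq₁]
      have := mul_nonpos_of_nonneg_of_nonpos (by positivity : 0 ≤ t ^ 2 / 2) (h₂ i heq heq₁)
      linarith

/-- This easy inclusion suffices: Farkas' lemma already delivers multipliers as combinations of
active normals, so the converse description of the normal cone is never used. -/
theorem combination_mem_normalCone_polyhedron {a : ι → F} {b : ι → ℝ} {q : F} {s : Finset ι}
    (hq : ∀ i, inner ℝ (a i) q ≤ b i) (hs : ∀ i ∈ s, inner ℝ (a i) q = b i) {l : ι → ℝ}
    (hl : ∀ i, 0 ≤ l i) :
    ∑ i ∈ s, l i • a i ∈ normalCone {q | ∀ i, inner ℝ (a i) q ≤ b i} q := by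
  refine mem_normalCone_of_forall_inner_nonpos hq fun u hu => ?_
  rw [sum_inner]
  refine Finset.sum_nonpos fun i hi => ?_
  rw [real_inner_smul_left, inner_sub_right, hs i hi]
  exact mul_nonpos_of_nonneg_of_nonpos (hl i) (sub_nonpos.2 (hu i))

end Polyhedra

/-! ### Derivatives of the constraint map -/

section SecondOrder

variable {E F : Type*} [NormedAddCommGroup E] [InnerProductSpace ℝ E]
  [NormedAddCommGroup F] [InnerProductSpace ℝ F]

theorem inner_fderiv_nonpos_of_mem_tangentCone {g : E → F} {Θ : Set F} {x v : E}
    (hg : DifferentiableAt ℝ g x) (hv : v ∈ tangentCone (feasibleSet g Θ) x) {a : F}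
    (ha : ∀ q ∈ Θ, inner ℝ a q ≤ inner ℝ a (g x)) : inner ℝ a (fderiv ℝ g x v) ≤ 0 := by
  obtain ⟨t, ws, ht, ht0, hws, hmem⟩ := hv
  have hlim := hg.hasFDerivAt.hasFDerivWithinAt (s := Set.univ) |>.lim (l := atTop)
    (c := fun k => (t k)⁻¹) (d := fun k => t k • ws k) (v := v)
    (by simpa using ht0.smul hws) (by simp)
    (by simpa [smul_smul, inv_mul_cancel₀ (ht _).ne'] using hws)
  refine le_of_tendsto ((tendsto_const_nhds (x := a)).inner hlim) (Eventually.of_forall fun k => ?_)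
  rw [real_inner_smul_right, inner_sub_right]
  exact mul_nonpos_of_nonneg_of_nonpos (inv_nonneg.2 (ht k).le) (sub_nonpos.2 (ha _ (hmem k)))

/-- The velocity of `g` along the parabola is `g'(c t)(v + t p)`, whose derivative at `0` is
`g''(x)(v, v) + g'(x) p`. -/
theorem isLittleO_comp_parabola {g : E → F} {x : E} (hg : ContDiffAt ℝ 2 g x) (v p : E) :
    (fun t : ℝ => g (x + t • v + (t ^ 2 / 2) • p) - (g x + t • fderiv ℝ g x v +
      (t ^ 2 / 2) • (fderiv ℝ (fderiv ℝ g) x v v + fderiv ℝ g x p))) =o[𝓝 0]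
      fun t : ℝ => t ^ 2 := by
  set c : ℝ → E := fun t => x + t • v + (t ^ 2 / 2) • p with hc
  have hc0 : c 0 = x := by simp [hc]
  have hcd : ∀ t, HasDerivAt c (v + t • p) t := fun t => by
    have h1 := (hasDerivAt_id t).smul_const v
    have h2 := (((hasDerivAt_id t).pow 2).div_const 2).smul_const p
    refine ((h1.const_add x).add h2).congr_deriv ?_
    have : (((2 : ℕ) : ℝ) * id t ^ (2 - 1) * 1) / 2 = t := by simp
    rw [this, one_smul]
  have hdiff : ∀ᶠ u in 𝓝 x, DifferentiableAt ℝ g u :=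
    (hg.eventually (by simp)).mono fun u hu => hu.differentiableAt (by simp)
  have hG : ∀ᶠ t in 𝓝 0, HasDerivAt (g ∘ c) (fderiv ℝ g (c t) (v + t • p)) t := by
    have hct : Tendsto c (𝓝 0) (𝓝 x) := hc0 ▸ (hcd 0).continuousAt.tendsto
    filter_upwards [hct.eventually hdiff] with t ht
    exact ht.hasFDerivAt.comp_hasDerivAt t (hcd t)
  have hg2 : DifferentiableAt ℝ (fderiv ℝ g) x :=
    (hg.fderiv_right (m := 1) (by norm_num)).differentiableAt (by simp)
  have hD1 : HasDerivAt (fun t => fderiv ℝ g (c t)) (fderiv ℝ (fderiv ℝ g) x v) 0 := by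
    have := hg2.hasFDerivAt
    rw [← hc0] at this
    refine (this.comp_hasDerivAt 0 (hcd 0)).congr_deriv ?_
    simp [hc0]
  have hD := hD1.clm_apply (((hasDerivAt_id (0 : ℝ)).smul_const p).const_add v)
  have := isLittleO_sq_of_hasDerivAt hG hD
  simpa [hc0] using this

theorem inner_scalarizedHessian_apply [CompleteSpace E] [CompleteSpace F] {g : E → F} {x : E}
    (hg : ContDiffAt ℝ 2 g x) (y : F) (w : E) :
    inner ℝ w (scalarizedHessian g y x w) = inner ℝ y (fderiv ℝ (fderiv ℝ g) x w w) := by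
  have hdiff : ∀ᶠ u in 𝓝 x, DifferentiableAt ℝ g u :=
    (hg.eventually (by simp)).mono fun u hu => hu.differentiableAt (by simp)
  have hg2 : DifferentiableAt ℝ (fderiv ℝ g) x :=
    (hg.fderiv_right (m := 1) (by norm_num)).differentiableAt (by simp)
  -- The gradient of `⟨y, g⟩` at `u` is `g'(u)* y`, which is linear in `g'(u)`; bundling `A ↦ A* y`
  -- as `T` lets the chain rule compute the Hessian.
  let T : (E →L[ℝ] F) →L[ℝ] E := LinearMap.mkContinuous
    { toFun := fun A => ContinuousLinearMap.adjoint A y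
      map_add' := fun A B => by simp
      map_smul' := fun r A => by simp } ‖y‖ fun A => by
        simpa [mul_comm] using (ContinuousLinearMap.adjoint A).le_opNorm y
  have heq : gradient (fun u => (inner ℝ y (g u) : ℝ)) =ᶠ[𝓝 x] fun u => T (fderiv ℝ g u) := by
    filter_upwards [hdiff] with u hu
    refine HasGradientAt.gradient ?_
    rw [hasGradientAt_iff_hasFDerivAt]
    refine (((innerSL ℝ y).hasFDerivAt).comp u hu.hasFDerivAt).congr_fderiv ?_
    ext v
    simp [T, ContinuousLinearMap.adjoint_inner_left]
  have : scalarizedHessian g y x = T.comp (fderiv ℝ (fderiv ℝ g) x) := by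
    rw [scalarizedHessian, heq.fderiv_eq]
    exact (T.hasFDerivAt.comp x hg2.hasFDerivAt).fderiv
  rw [this]
  simp [T, ContinuousLinearMap.adjoint_inner_right, real_inner_comm]

end SecondOrder

/-! ### Optimality conditions -/

section OptimalityConditions

variable {ι E F : Type*} [NormedAddCommGroup E] [InnerProductSpace ℝ E] [CompleteSpace E]
  [NormedAddCommGroup F] [InnerProductSpace ℝ F]
  {f : E → ℝ} {g : E → F} {a : ι → F} {b : ι → ℝ} {x : E}

/-- Linearized feasible directions are not descent directions at a local minimizer. -/
theorem IsLocalMinimizer.inner_gradient_nonneg [Finite ι]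
    (hx : IsLocalMinimizer f (feasibleSet g {q | ∀ i, inner ℝ (a i) q ≤ b i}) x)
    (hf : DifferentiableAt ℝ f x) (hg : DifferentiableAt ℝ g x)
    (hM : MSCQ g {q | ∀ i, inner ℝ (a i) q ≤ b i} x) {v : E}
    (hv : ∀ i, inner ℝ (a i) (g x) = b i → inner ℝ (a i) (fderiv ℝ g x v) ≤ 0) :
    0 ≤ inner ℝ (gradient f x) v := by
  obtain ⟨hxΓ, hmin⟩ := hx
  have hray : HasDerivAt (fun t : ℝ => x + t • v) v 0 := by
    simpa using ((hasDerivAt_id (0 : ℝ)).smul_const v).const_add x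
  have hray0 : Tendsto (fun t : ℝ => x + t • v) (𝓝[>] 0) (𝓝 x) := by
    simpa using hray.continuousAt.tendsto.mono_left nhdsWithin_le_nhds
  have hgray : HasDerivAt (fun t : ℝ => g (x + t • v)) (fderiv ℝ g x v) 0 := by
    have h0 : HasFDerivAt g (fderiv ℝ g x) (x + (0 : ℝ) • v) := by simpa using hg.hasFDerivAt
    exact h0.comp_hasDerivAt 0 hray
  obtain ⟨u, huΓ, hu⟩ := hM.exists_feasible_curve hxΓ (k := 1) hray0
    (eventually_parabola_mem_polyhedron (q₂ := 0) hxΓ hv (by simp)) (by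
      simpa [sub_sub] using (hasDerivAt_iff_isLittleO.1 hgray).mono nhdsWithin_le_nhds)
  have he : Tendsto (fun t => t⁻¹ • (u t - (x + t • v))) (𝓝[>] 0) (𝓝 0) := by
    simpa using hu.tendsto_inv_smul_nhds_zero
  have hd : Tendsto (fun t => t⁻¹ • (u t - x)) (𝓝[>] 0) (𝓝 v) := by
    have := he.add_const v
    rw [zero_add] at this
    refine this.congr' ?_
    filter_upwards [self_mem_nhdsWithin] with t ht
    rw [← sub_sub, smul_sub _ (u t - x), smul_smul, inv_mul_cancel₀ (ne_of_gt ht), one_smul,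
      sub_add_cancel]
  have hux : Tendsto (fun t => u t - x) (𝓝[>] 0) (𝓝 0) := by
    have := (tendsto_id.mono_left nhdsWithin_le_nhds :
      Tendsto (fun t : ℝ => t) (𝓝[>] 0) (𝓝 0)).smul hd
    rw [zero_smul] at this
    refine this.congr' ?_
    filter_upwards [self_mem_nhdsWithin] with t ht
    exact smul_inv_smul₀ (ne_of_gt ht) _
  have hlim := hf.hasGradientAt.hasFDerivAt.hasFDerivWithinAt (s := Set.univ) |>.lim
    hux (by simp) hd
  rw [InnerProductSpace.toDual_apply_apply] at hlim
  refine ge_of_tendsto hlim ?_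
  have hux' : Tendsto u (𝓝[>] 0) (𝓝 x) := by simpa using hux.add_const x
  have hmin' := (tendsto_nhdsWithin_iff.2 ⟨hux', huΓ⟩).eventually hmin
  filter_upwards [self_mem_nhdsWithin, hmin'] with t ht hft
  rw [add_sub_cancel]
  exact mul_nonneg (inv_nonneg.2 (le_of_lt ht)) (sub_nonneg.2 hft)

/-- The first-order optimality condition under MSCQ, with the multiplier represented as a
nonnegative combination of the active constraint normals. -/
theorem IsLocalMinimizer.exists_multiplier_combination [CompleteSpace F] [Finite ι]
    (hx : IsLocalMinimizer f (feasibleSet g {q | ∀ i, inner ℝ (a i) q ≤ b i}) x)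
    (hf : DifferentiableAt ℝ f x) (hg : DifferentiableAt ℝ g x)
    (hM : MSCQ g {q | ∀ i, inner ℝ (a i) q ≤ b i} x) {s : Finset ι}
    (hs : ∀ i, i ∈ s ↔ inner ℝ (a i) (g x) = b i) :
    ∃ l : ι → ℝ, (∀ i, 0 ≤ l i) ∧
      gradient f x + ContinuousLinearMap.adjoint (fderiv ℝ g x) (∑ i ∈ s, l i • a i) = 0 := by
  obtain ⟨l, hl, hc⟩ := exists_nonneg_combination_of_forall_nonpos s
    (fun i => ((innerSL ℝ (a i)).comp (fderiv ℝ g x)).toLinearMap)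
    (-(innerSL ℝ (gradient f x))).toLinearMap (fun v hv => by
      have := hx.inner_gradient_nonneg hf hg hM (v := v) fun i hi => by
        simpa using hv i ((hs i).2 hi)
      simpa using this)
  refine ⟨l, hl, ext_inner_right ℝ fun v => ?_⟩
  have := LinearMap.congr_fun hc v
  simp only [ContinuousLinearMap.coe_coe, neg_apply, innerSL_apply_apply,
    LinearMap.sum_apply, LinearMap.smul_apply, ContinuousLinearMap.comp_apply,
    smul_eq_mul] at this
  rw [inner_add_left, ContinuousLinearMap.adjoint_inner_left, sum_inner, inner_zero_left]
  simp only [real_inner_smul_left]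
  linarith

/-- Second-order necessary condition along a second-order feasible direction `p`. -/
theorem le_of_second_order_feasible [Finite ι] {σ : ℝ} {w z p : E}
    (hx : IsStrongLocalMinimizer f (feasibleSet g {q | ∀ i, inner ℝ (a i) q ≤ b i}) σ x)
    (hf : IsC11Around f x) (hg : ContDiffAt ℝ 2 g x)
    (hM : MSCQ g {q | ∀ i, inner ℝ (a i) q ≤ b i} x)
    (hz : z ∈ combinedSecondSubdiffReal f x w) (hfw : inner ℝ (gradient f x) (-w) = 0)
    (hw : ∀ i, inner ℝ (a i) (g x) = b i → inner ℝ (a i) (fderiv ℝ g x (-w)) ≤ 0)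
    (hp : ∀ i, inner ℝ (a i) (g x) = b i → inner ℝ (a i) (fderiv ℝ g x (-w)) = 0 →
      inner ℝ (a i) (fderiv ℝ (fderiv ℝ g) x (-w) (-w) + fderiv ℝ g x p) ≤ 0) :
    σ * ‖w‖ ^ 2 ≤ inner ℝ z w + inner ℝ (gradient f x) p := by
  obtain ⟨hxΓ, V, hV, hmin⟩ := hx
  set c : ℝ → E := fun t => x + t • -w + (t ^ 2 / 2) • p with hc
  have hc0 : Tendsto c (𝓝[>] 0) (𝓝 x) := by
    have : Continuous c := by fun_prop
    simpa [hc] using (this.tendsto 0).mono_left nhdsWithin_le_nhds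
  obtain ⟨u, huΓ, hu⟩ := hM.exists_feasible_curve hxΓ (k := 2) hc0
    (eventually_parabola_mem_polyhedron hxΓ hw hp)
    ((isLittleO_comp_parabola hg (-w) p).mono nhdsWithin_le_nhds)
  -- `e` is the deviation of `u` from the ray, not from the parabola, in units of `t²`; hence the
  -- limit `p / 2`.
  set e : ℝ → E := fun t => (t ^ 2)⁻¹ • (u t - c t) + (1 / 2 : ℝ) • p with he
  have he0 : Tendsto e (𝓝[>] 0) (𝓝 ((1 / 2 : ℝ) • p)) := by
    have := hu.tendsto_inv_smul_nhds_zero.add_const ((1 / 2 : ℝ) • p)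
    rwa [zero_add] at this
  have hue : ∀ t : ℝ, 0 < t → u t - (x + t • -w) = t ^ 2 • e t := fun t ht => by
    have : t ^ 2 ≠ 0 := by positivity
    simp only [he, hc, smul_add, smul_smul, mul_inv_cancel₀ this, one_smul]
    rw [mul_one_div]
    abel
  have hid : Tendsto (fun t : ℝ => t) (𝓝[>] 0) (𝓝 0) := tendsto_id.mono_left nhdsWithin_le_nhds
  set d : ℝ → E := fun t => -w + t • e t with hd
  have hd0 : Tendsto d (𝓝[>] 0) (𝓝 (-w)) := by
    simpa using (hid.smul he0).const_add (-w)
  have hud : ∀ t : ℝ, 0 < t → u t - x = t • d t := fun t ht => by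
    have := hue t ht
    rw [← sub_sub, sub_eq_iff_eq_add] at this
    rw [this]
    module
  have hux : Tendsto u (𝓝[>] 0) (𝓝 x) := by
    have := (hid.smul hd0).const_add x
    rw [zero_smul, add_zero] at this
    refine this.congr' ?_
    filter_upwards [self_mem_nhdsWithin] with t ht
    rw [← hud t ht, add_sub_cancel]
  obtain ⟨L, hL, δ, hδ, hLip⟩ := hf.exists_abs_sub_sub_inner_le
  refine le_of_forall_pos_le_add fun ε hε => ?_
  have hray := eventually_le_of_mem_combinedSecondSubdiffReal hf hz hε
  have hr : ∀ᶠ t : ℝ in 𝓝[>] 0, t * (‖w‖ + 1) < δ :=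
    Tendsto.eventually_lt_const hδ (by simpa using hid.mul_const (‖w‖ + 1))
  have hdn : ∀ᶠ t : ℝ in 𝓝[>] 0, ‖d t‖ < ‖w‖ + 1 :=
    hd0.norm.eventually_lt_const (by simp)
  -- Both `u t` and the ray point lie in the ball of radius `t * (‖w‖ + 1)`, so passing between them
  -- changes `f` by `t² ⟨∇f(x), e t⟩` up to `O(t³)`. The estimate is then divided by `t²`.
  have hkey : ∀ᶠ t : ℝ in 𝓝[>] 0, σ / 2 * ‖d t‖ ^ 2 ≤
      t * (L * (‖w‖ + 1) * ‖e t‖) + (inner ℝ z w + ε) / 2 + inner ℝ (gradient f x) (e t) := by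
    filter_upwards [self_mem_nhdsWithin, hray, hr, hdn, huΓ, hux hV] with t ht h1 h2 h3 h4 h5
    have ht : 0 < t := ht
    have hmin := hmin _ h5 h4
    have hlip := hLip _ h2.le (x + t • -w) (by
      rw [mem_closedBall_iff_norm, add_sub_cancel_left, norm_smul, norm_neg,
        Real.norm_of_nonneg ht.le]
      gcongr
      linarith) (u t) (by
      rw [mem_closedBall_iff_norm, hud t ht, norm_smul, Real.norm_of_nonneg ht.le]
      gcongr)
    rw [hue t ht, norm_smul, Real.norm_of_nonneg (by positivity), inner_smul_right] at hlip
    rw [hud t ht, norm_smul, Real.norm_of_nonneg ht.le] at hmin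
    rw [hfw] at h1
    have hlip := (abs_le.1 hlip).2
    have ht2 : 0 < t ^ 2 := by positivity
    refine le_of_mul_le_mul_left ?_ ht2
    linear_combination hmin + hlip + h1
  have hlim := le_of_tendsto_of_tendsto ((hd0.norm.pow 2).const_mul (σ / 2))
    (((hid.mul (he0.norm.const_mul (L * (‖w‖ + 1)))).add_const ((inner ℝ z w + ε) / 2)).add
      (tendsto_const_nhds.inner he0)) hkey
  rw [norm_neg, zero_mul, zero_add, inner_smul_right] at hlim
  linarith

/-- If the multiplier is unique, linear programming duality produces a second-order feasible
direction `p` at which the multiplier value is attained. -/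
theorem exists_second_order_direction [CompleteSpace F] {s J : Finset ι} (hJ : J ⊆ s) {l : ι → ℝ}
    (hl : ∀ i, 0 ≤ l i) {c : E} {A : E →L[ℝ] F}
    (hy : c + ContinuousLinearMap.adjoint A (∑ i ∈ s, l i • a i) = 0)
    (huniq : ∀ l' : ι → ℝ, (∀ i, 0 ≤ l' i) →
      c + ContinuousLinearMap.adjoint A (∑ i ∈ s, l' i • a i) = 0 →
      ∑ i ∈ s, l' i • a i = ∑ i ∈ s, l i • a i) (β : F) :
    ∃ p, (∀ i ∈ J, inner ℝ (a i) (β + A p) ≤ 0) ∧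
      inner ℝ c p ≤ inner ℝ (∑ i ∈ s, l i • a i) β := by
  classical
  set y := ∑ i ∈ s, l i • a i with hydef
  have hext : ∀ k : ι → ℝ, ∑ i ∈ s, (if i ∈ J then k i else 0) • a i = ∑ i ∈ J, k i • a i := by
    intro k
    simp only [ite_smul, zero_smul]
    rw [← Finset.sum_filter, Finset.filter_mem_eq_inter, Finset.inter_eq_right.2 hJ]
  -- The index `none` carries the bound on `⟨c, p⟩`, the indices `some i` the constraints in `J`.
  obtain ⟨p, hp⟩ := exists_forall_le_of_forall_combination (Finset.insertNone J)
    (fun o => o.elim (innerSL ℝ c).toLinearMap fun i => ((innerSL ℝ (a i)).comp A).toLinearMap)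
    (fun o => o.elim (inner ℝ y β) fun i => -inner ℝ (a i) β) (fun k hk hsum => by
      set y' := ∑ i ∈ J, k (some i) • a i with hy'
      have hval : ∑ i ∈ J, k (some i) * inner ℝ (a i) β = inner ℝ y' β := by
        simp [hy', sum_inner, real_inner_smul_left]
      have hadj : k none • c + ContinuousLinearMap.adjoint A y' = 0 := by
        refine ext_inner_right ℝ fun v => ?_
        have := LinearMap.congr_fun hsum v
        simp only [Finset.sum_insertNone, Option.elim, LinearMap.add_apply, LinearMap.sum_apply,
          LinearMap.smul_apply, ContinuousLinearMap.coe_coe, innerSL_apply_apply,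
          ContinuousLinearMap.comp_apply, smul_eq_mul, LinearMap.zero_apply] at this
        rw [inner_add_left, ContinuousLinearMap.adjoint_inner_left, inner_zero_left, hy',
          sum_inner, real_inner_smul_left]
        simpa only [real_inner_smul_left] using this
      simp only [Finset.sum_insertNone, Option.elim, mul_neg, Finset.sum_neg_distrib, hval]
      suffices h : y' = k none • y by simp [h, real_inner_smul_left]
      -- If `k none = 0`, then `y + y'` is again a multiplier, so `y' = 0`; otherwise `y' / k none`
      -- is a multiplier, so it equals `y`. Only the vector must be unique, not its coefficients.
      rcases (hk none).eq_or_lt with h0 | hpos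
      · rw [← h0, zero_smul] at hadj ⊢
        rw [zero_add] at hadj
        have h := huniq (fun i => l i + if i ∈ J then k (some i) else 0)
          (fun i => add_nonneg (hl i) (by split_ifs; exacts [hk _, le_rfl])) (by
            simp only [add_smul, Finset.sum_add_distrib]
            rw [hext fun i => k (some i), ← hydef, ← hy', map_add, hadj, add_zero, hy])
        simp only [add_smul, Finset.sum_add_distrib] at h
        rw [hext fun i => k (some i), ← hydef, ← hy'] at h
        simpa using h
      · have hscale : ∑ i ∈ s, ((if i ∈ J then (k none)⁻¹ * k (some i) else 0)) • a i =
            (k none)⁻¹ • y' := by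
          rw [hext fun i => (k none)⁻¹ * k (some i), hy', Finset.smul_sum]
          simp only [smul_smul]
        have h := huniq (fun i => if i ∈ J then (k none)⁻¹ * k (some i) else 0)
          (fun i => by
            split_ifs
            exacts [mul_nonneg (inv_nonneg.2 hpos.le) (hk _), le_rfl]) (by
            rw [hscale, map_smul, ← smul_zero (k none)⁻¹, ← hadj, smul_add,
              inv_smul_smul₀ hpos.ne'])
        rw [hscale] at h
        rw [← h, smul_inv_smul₀ hpos.ne'])
  refine ⟨p, fun i hi => ?_, by simpa using hp none (by simp)⟩
  have := hp (some i) (by simpa using hi)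
  simp only [Option.elim, ContinuousLinearMap.coe_coe, ContinuousLinearMap.comp_apply,
    innerSL_apply_apply] at this
  rw [inner_add_right]
  linarith

/-- The second-order necessary condition when all multipliers coincide; `σ = 0` covers ordinary
local minimizers. -/
theorem IsStrongLocalMinimizer.le_inner_add_inner_hessian [CompleteSpace F] [Finite ι] {σ : ℝ} {w z : E}
    (hx : IsStrongLocalMinimizer f (feasibleSet g {q | ∀ i, inner ℝ (a i) q ≤ b i}) σ x)
    (hf : IsC11Around f x) (hg : ContDiffAt ℝ 2 g x)
    (hM : MSCQ g {q | ∀ i, inner ℝ (a i) q ≤ b i} x) {s : Finset ι}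
    (hs : ∀ i, i ∈ s ↔ inner ℝ (a i) (g x) = b i) {l : ι → ℝ} (hl : ∀ i, 0 ≤ l i)
    (hy : multipliers f g {q | ∀ i, inner ℝ (a i) q ≤ b i} x = {∑ i ∈ s, l i • a i})
    (hw : -w ∈ criticalCone (feasibleSet g {q | ∀ i, inner ℝ (a i) q ≤ b i}) x (-gradient f x))
    (hz : z ∈ combinedSecondSubdiffReal f x w) :
    σ * ‖w‖ ^ 2 ≤ inner ℝ z w +
      inner ℝ w (scalarizedHessian g (∑ i ∈ s, l i • a i) x w) := by
  classical
  obtain ⟨hwT, hwf⟩ := hw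
  have hfw : inner ℝ (gradient f x) (-w) = 0 := by
    simpa only [Set.mem_ofPred_eq, inner_neg_left, neg_eq_zero] using hwf
  have hxΓ : ∀ i, inner ℝ (a i) (g x) ≤ b i := hx.1
  obtain ⟨p, hp, hfp⟩ := exists_second_order_direction (a := a)
    (J := s.filter fun i => inner ℝ (a i) (fderiv ℝ g x (-w)) = 0) (Finset.filter_subset _ _) hl
    (hy.symm ▸ Set.mem_singleton _ : ∑ i ∈ s, l i • a i ∈ multipliers f g _ x).2
    (fun l' hl' h => by
      have : ∑ i ∈ s, l' i • a i ∈ multipliers f g {q | ∀ i, inner ℝ (a i) q ≤ b i} x :=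
        ⟨combination_mem_normalCone_polyhedron hxΓ (fun i hi => (hs i).1 hi) hl', h⟩
      rwa [hy] at this)
    (fderiv ℝ (fderiv ℝ g) x (-w) (-w))
  rw [inner_scalarizedHessian_apply hg]
  have hneg : fderiv ℝ (fderiv ℝ g) x (-w) (-w) = fderiv ℝ (fderiv ℝ g) x w w := by simp
  rw [hneg] at hfp
  refine (le_of_second_order_feasible hx hf hg hM hz hfw
    (fun i hi => inner_fderiv_nonpos_of_mem_tangentCone (hg.differentiableAt (by simp)) hwT
      fun q hq => hi.symm ▸ hq i)
    fun i hi h0 => hp i (Finset.mem_filter.2 ⟨(hs i).2 hi, h0⟩)).trans ?_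
  linarith

end OptimalityConditions

end VarAnalysis

theorem theorem7p3 {n m : ℕ}
    (f : EuclideanSpace ℝ (Fin n) → ℝ)
    (g : EuclideanSpace ℝ (Fin n) → EuclideanSpace ℝ (Fin m))
    (Θ : Set (EuclideanSpace ℝ (Fin m)))
    (x : EuclideanSpace ℝ (Fin n))
    (hΘne : Θ.Nonempty) (hΘ : VarAnalysis.IsConvexPolyhedron Θ)
    (hx : VarAnalysis.IsLocalMinimizer f (VarAnalysis.feasibleSet g Θ) x)
    (hf : VarAnalysis.IsC11Around f x)
    (hg : ContDiffAt ℝ 2 g x)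
    (hMSCQ : VarAnalysis.MSCQ g Θ x) :
    (VarAnalysis.multipliers f g Θ x).Nonempty ∧
    ∀ y : EuclideanSpace ℝ (Fin m), VarAnalysis.multipliers f g Θ x = {y} →
      (∀ w, -w ∈ VarAnalysis.criticalCone (VarAnalysis.feasibleSet g Θ) x (-gradient f x) →
        ∀ z ∈ VarAnalysis.combinedSecondSubdiffReal f x w,
          0 ≤ (inner ℝ z w : ℝ) + inner ℝ w (VarAnalysis.scalarizedHessian g y x w)) ∧
      (∀ σ : ℝ, 0 < σ →
        VarAnalysis.IsStrongLocalMinimizer f (VarAnalysis.feasibleSet g Θ) σ x →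
        ∀ w, -w ∈ VarAnalysis.criticalCone (VarAnalysis.feasibleSet g Θ) x (-gradient f x) →
          ∀ z ∈ VarAnalysis.combinedSecondSubdiffReal f x w,
            σ * ‖w‖ ^ 2 ≤
              (inner ℝ z w : ℝ) + inner ℝ w (VarAnalysis.scalarizedHessian g y x w)) := by
  classical
  obtain ⟨k, a, b, rfl⟩ := hΘ
  obtain ⟨U, hU, hd, -⟩ := id hf
  obtain ⟨l, hl, hmul⟩ := hx.exists_multiplier_combination (hd x (mem_of_mem_nhds hU))
    (hg.differentiableAt (by simp)) hMSCQ
    (s := Finset.univ.filter fun i => inner ℝ (a i) (g x) = b i) (by simp)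
  have hmem := And.intro (VarAnalysis.combination_mem_normalCone_polyhedron (a := a) (b := b) hx.1
    (s := Finset.univ.filter fun i => inner ℝ (a i) (g x) = b i) (by simp) hl) hmul
  -- Uniqueness identifies `y` with the Farkas combination, which gives it nonnegative coefficients
  -- on the active constraints.
  refine ⟨⟨_, hmem⟩, fun y hy => ?_⟩
  have hyl : _ = y := hy.subset hmem
  subst hyl
  refine ⟨fun w hw z hz => ?_, fun σ _ hσ w hw z hz =>
    hσ.le_inner_add_inner_hessian hf hg hMSCQ (by simp) hl hy hw hz⟩
  have h0 : VarAnalysis.IsStrongLocalMinimizer f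
      (VarAnalysis.feasibleSet g {q | ∀ i, inner ℝ (a i) q ≤ b i}) 0 x := by
    obtain ⟨V, hV, hVmin⟩ := mem_nhdsWithin_iff_exists_mem_nhds_inter.1 hx.2
    exact ⟨hx.1, V, hV, fun u hu huΓ => by simpa using hVmin ⟨hu, huΓ⟩⟩
  simpa using h0.le_inner_add_inner_hessian hf hg hMSCQ (by simp) hl hy hw hz
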